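/- Let $K\ge 2$ and let $p=(p_{ij})_{1\le i,j\le K}$ be the transition matrix of an irreducible, aperiodic Markov chain on $\{1,\dots,K\}$. Fix a state $i_0$ (for instance $i_0=1$). Boxes are indexed by the finite words over $\{1,\dots,K\}$: the box of the empty word has type $i_0$ and size $1$, and a box of type $i$ and size $s$ is divided at the next generation into sub-boxes of types $k=1,\dots,K$ and sizes $s\,p_{ik}$; sub-boxes of size $0$ are discarded. Let $\underline l^{(n)}$ and $\overline l^{(n)}$ be the sizes of the smallest and of the largest box at generation $n$, that is, the minimum and the maximum of the (positive) sizes of the boxes of words of length $n$. For $\theta\in\mathbb R$ let $A(\theta)=(p_{ij}^\theta)_{i,j}$, with the convention $0^\theta=0$ for every $\theta$, and let $\rho(\theta)$ be the maximum modulus eigenvalue of $A(\theta)$, i.e. the real number that is a simple root of the characteristic polynomial of $A(\theta)$ and whose modulus is strictly larger than that of every other complex root. Then $\rho(\theta)$ exists for every $\theta$, $\rho$ is differentiable on $\mathbb R$ with $\rho'<0$, the minimum $\underline l^{(n)}$ and the maximum $\overline l^{(n)}$ are attained for every $n\ge 0$, the limits $$C_*=\lim_{\theta\to-\infty}\frac{\rho(\theta)}{-\rho'(\theta)},\qquad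 C^*=\lim_{\theta\to\infty}\frac{\rho(\theta)}{-\rho'(\theta)}$$ exist and satisfy $0<C_*\le C^*<\infty$, and $$\lim_{n\to\infty}\frac{\ln \underline l^{(n)}}{n}=-\frac1{C_*},\qquad \lim_{n\to\infty}\frac{\ln \overline l^{(n)}}{n}=-\frac1{C^*}.$$ -/

import Mathlib

open Filter Topology

namespace MarkovBoxes

noncomputable section

variable {K : ℕ}

/-- A transition matrix `p` is aperiodic if for every state `i` the greatest common divisor of the
possible return times `{n ≥ 1 : (p ^ n) i i > 0}` is one. -/
def IsAperiodic (p : Matrix (Fin K) (Fin K) ℝ) : Prop :=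
  ∀ i, Nat.setGcd {n : ℕ | 0 < n ∧ 0 < (p ^ n) i i} = 1

/-- Type of the box of a word `u = (i₁, …, iₙ)`: its last letter, and `i₀` for the empty word. -/
def boxType (i₀ : Fin K) : {n : ℕ} → (Fin n → Fin K) → Fin K
  | 0, _ => i₀
  | n + 1, u => u (Fin.last n)

/-- Size of the box of a word: the root box has size one, and a box of type `i` is divided into
sub-boxes, the one of type `k` having `p i k` times its size. -/
def boxSize (p : Matrix (Fin K) (Fin K) ℝ) (i₀ : Fin K) : {n : ℕ} → (Fin n → Fin K) → ℝ
  | 0, _ => 1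
  | n + 1, u => boxSize p i₀ (Fin.init u) * p (boxType i₀ (Fin.init u)) (u (Fin.last n))

theorem boxSize_snoc (p : Matrix (Fin K) (Fin K) ℝ) (i₀ : Fin K) {n : ℕ} (u : Fin n → Fin K)
    (k : Fin K) :
    boxSize p i₀ (Fin.snoc u k : Fin (n + 1) → Fin K)
      = boxSize p i₀ u * p (boxType i₀ u) k := by
  simp [boxSize]

/-- The set of sizes of the boxes that are present at generation `n`. Words with
`boxSize p i₀ u = 0` contain a forbidden transition and correspond to no box. -/
def boxSizes (p : Matrix (Fin K) (Fin K) ℝ) (i₀ : Fin K) (n : ℕ) : Set ℝ :=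
  {x | 0 < x ∧ ∃ u : Fin n → Fin K, boxSize p i₀ u = x}

/-- Size of the smallest box at generation `n`. -/
def smallestBox (p : Matrix (Fin K) (Fin K) ℝ) (i₀ : Fin K) (n : ℕ) : ℝ :=
  sInf (boxSizes p i₀ n)

/-- Size of the largest box at generation `n`. -/
def largestBox (p : Matrix (Fin K) (Fin K) ℝ) (i₀ : Fin K) (n : ℕ) : ℝ :=
  sSup (boxSizes p i₀ n)

/-- The matrix `A(θ) = (p_{ij} ^ θ)`, with the convention `0 ^ θ = 0` for every `θ`. -/
def powMatrix (p : Matrix (Fin K) (Fin K) ℝ) (θ : ℝ) : Matrix (Fin K) (Fin K) ℝ :=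
  Matrix.of fun i j => if p i j = 0 then 0 else p i j ^ θ

/-- `r` is a maximum modulus eigenvalue of `A`: it is a simple root of the (complex)
characteristic polynomial and its modulus is strictly larger than that of every other root. -/
def IsMaxModulusEigenvalue (A : Matrix (Fin K) (Fin K) ℝ) (r : ℝ) : Prop :=
  (A.map Complex.ofReal).charpoly.rootMultiplicity (r : ℂ) = 1 ∧
    ∀ z : ℂ, (A.map Complex.ofReal).charpoly.IsRoot z → z ≠ (r : ℂ) → ‖z‖ < |r|

theorem IsMaxModulusEigenvalue.unique {A : Matrix (Fin K) (Fin K) ℝ} {r s : ℝ}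
    (hr : IsMaxModulusEigenvalue A r) (hs : IsMaxModulusEigenvalue A s) : r = s := by
  by_contra hne
  have root : ∀ t : ℝ, IsMaxModulusEigenvalue A t →
      (A.map Complex.ofReal).charpoly.IsRoot (t : ℂ) := fun t ht =>
    (Polynomial.rootMultiplicity_pos (Matrix.charpoly_monic _).ne_zero).1 (by rw [ht.1]; norm_num)
  have h1 := hr.2 s (root s hs) (by exact_mod_cast Ne.symm hne)
  have h2 := hs.2 r (root r hr) (by exact_mod_cast hne)
  rw [Complex.norm_real, Real.norm_eq_abs] at h1 h2
  exact lt_asymm h1 h2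

open Classical in
/-- The maximum modulus eigenvalue of `A` (zero if there is none). -/
def maxModulusEigenvalue (A : Matrix (Fin K) (Fin K) ℝ) : ℝ :=
  if h : ∃ r : ℝ, IsMaxModulusEigenvalue A r then h.choose else 0

theorem IsMaxModulusEigenvalue.eq_maxModulusEigenvalue {A : Matrix (Fin K) (Fin K) ℝ} {r : ℝ}
    (hr : IsMaxModulusEigenvalue A r) : maxModulusEigenvalue A = r := by
  have h : ∃ r : ℝ, IsMaxModulusEigenvalue A r := ⟨r, hr⟩
  rw [maxModulusEigenvalue, dif_pos h]
  exact h.choose_spec.unique hr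

/-- `ρ(θ)`, the maximum modulus eigenvalue of `A(θ)`. -/
def rho (p : Matrix (Fin K) (Fin K) ℝ) (θ : ℝ) : ℝ :=
  maxModulusEigenvalue (powMatrix p θ)

end

end MarkovBoxes

/-!
`ρ(θ)` is the Perron root of the primitive matrix `A(θ)`. The entries of `A(θ) ^ n` are sums of
`s ^ θ` over the sizes `s` of the boxes of generation `n`, so `θ log s ≤ n log ρ(θ) + O(1)` for each
such box; and since passing from `A(θ) ^ n` to `A(θ + 1) ^ n` multiplies the contribution of a box
by its size, `n (log ρ(θ + 1) - log ρ(θ)) ≤ log (largest size) + O(1)`. By Hölder's inequality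
`log ρ` is convex, so these two bounds identify the growth rate of the largest box with the limit of
`ρ' / ρ` at `+∞`; the smallest box corresponds to `θ ↦ -θ`. The limits are finite and negative
because for some `N` all boxes of generation `N` have sizes in an interval `[a, b]` with
`0 < a` and `b < 1`, which confines `ρ' / ρ` to `[log a / N, log b / N]`.
-/

namespace MarkovBoxes

open Matrix

/-! ### Positive eigenvectors of nonnegative matrices -/

section PositiveEigenvectors

variable {n : Type*} [Fintype n]

theorem dotProduct_pos_of_pos {w x : n → ℝ} (hw : ∀ i, 0 < w i) (hx : 0 ≤ x) (hx0 : x ≠ 0) :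
    0 < w ⬝ᵥ x := by
  obtain ⟨j, hj⟩ := Function.ne_iff.1 hx0
  exact Finset.sum_pos' (fun i _ => mul_nonneg (hw i).le (hx i))
    ⟨j, Finset.mem_univ j, mul_pos (hw j) ((hx j).lt_of_ne' hj)⟩

theorem mulVec_mono_of_nonneg {B : Matrix n n ℝ} (hB : ∀ i j, 0 ≤ B i j) : Monotone (B *ᵥ ·) :=
  fun _ _ hxy i => dotProduct_le_dotProduct_of_nonneg_left hxy (hB i)

theorem mulVec_pos_of_pos {B : Matrix n n ℝ} (hB : ∀ i j, 0 < B i j) {x : n → ℝ} (hx : 0 ≤ x)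
    (hx0 : x ≠ 0) (i : n) : 0 < (B *ᵥ x) i :=
  dotProduct_pos_of_pos (hB i) hx hx0

theorem exists_pos_mul_le {ι : Type*} [Finite ι] (y : ι → ℝ) {z : ι → ℝ} (hz : ∀ i, 0 < z i) :
    ∃ ε > 0, ∀ i, ε * y i ≤ z i := by
  have hsmall : ∀ᶠ ε in 𝓝[>] (0 : ℝ), ∀ i, ε * y i < z i := by
    refine eventually_all.2 fun i => nhdsWithin_le_nhds ?_
    have hlim : Tendsto (· * y i) (𝓝 (0 : ℝ)) (𝓝 (0 * y i)) := tendsto_id.mul_const _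
    exact hlim.eventually_lt_const (by simpa using hz i)
  obtain ⟨ε, hε, hlt⟩ := (eventually_mem_nhdsWithin.and hsmall).exists
  exact ⟨ε, hε, fun i => (hlt i).le⟩

theorem exists_pos_smul_mem_stdSimplex {x : n → ℝ} (hx : 0 ≤ x) (hx0 : x ≠ 0) :
    ∃ c : ℝ, 0 < c ∧ c • x ∈ stdSimplex ℝ n := by
  have hsum : 0 < ∑ i, x i := by
    simpa [dotProduct] using dotProduct_pos_of_pos (w := 1) (by simp) hx hx0
  refine ⟨(∑ i, x i)⁻¹, inv_pos.2 hsum, fun i => mul_nonneg (inv_pos.2 hsum).le (hx i), ?_⟩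
  simp only [Pi.smul_apply, smul_eq_mul, ← Finset.mul_sum, inv_mul_cancel₀ hsum.ne']

theorem ne_zero_of_mem_stdSimplex {x : n → ℝ} (hx : x ∈ stdSimplex ℝ n) : x ≠ 0 := by
  rintro rfl
  simpa using hx.2

theorem pow_mulVec_of_mulVec_eq_smul [DecidableEq n] {R : Type*} [CommSemiring R]
    {A : Matrix n n R} {r : R} {x : n → R} (h : A *ᵥ x = r • x) (k : ℕ) :
    A ^ k *ᵥ x = r ^ k • x := by
  induction k with
  | zero => simp
  | succ k ih => rw [pow_succ, ← mulVec_mulVec, h, mulVec_smul, ih, smul_smul, pow_succ']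

/-- A positive (right) eigenvector `v` of a real matrix `A` for the eigenvalue `r`. Positive left
eigenvectors of `A` are encoded as positive eigenvectors of `Aᵀ`. -/
structure IsPosEigenvector (A : Matrix n n ℝ) (r : ℝ) (v : n → ℝ) : Prop where
  pos : ∀ i, 0 < v i
  mulVec_eq : A *ᵥ v = r • v

variable {A : Matrix n n ℝ} {r s : ℝ} {v w x : n → ℝ}

namespace IsPosEigenvector

theorem nonneg (hv : IsPosEigenvector A r v) : 0 ≤ v := fun i => (hv.pos i).le

theorem ne_zero [Nonempty n] (hv : IsPosEigenvector A r v) : v ≠ 0 :=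
  Function.ne_iff.2 ⟨Classical.arbitrary n, (hv.pos _).ne'⟩

theorem pow [DecidableEq n] (hv : IsPosEigenvector A r v) (k : ℕ) :
    IsPosEigenvector (A ^ k) (r ^ k) v :=
  ⟨hv.pos, pow_mulVec_of_mulVec_eq_smul hv.mulVec_eq k⟩

theorem map_mulVec_eq {F : Type*} [Semiring F] (f : ℝ →+* F) (hv : IsPosEigenvector A r v) :
    A.map f *ᵥ (f ∘ v) = f r • (f ∘ v) :=
  funext fun i => by
    rw [← RingHom.map_mulVec, hv.mulVec_eq, Pi.smul_apply, smul_eq_mul, map_mul]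
    rfl

theorem dotProduct_mulVec (hw : IsPosEigenvector Aᵀ r w) (x : n → ℝ) :
    w ⬝ᵥ A *ᵥ x = r * (w ⬝ᵥ x) := by
  rw [Matrix.dotProduct_mulVec, ← mulVec_transpose, hw.mulVec_eq, smul_dotProduct, smul_eq_mul]

theorem le_of_smul_le_mulVec (hw : IsPosEigenvector Aᵀ r w) (hx : 0 ≤ x) (hx0 : x ≠ 0)
    (h : s • x ≤ A *ᵥ x) : s ≤ r := by
  refine le_of_mul_le_mul_right ?_ (dotProduct_pos_of_pos hw.pos hx hx0)
  calc s * (w ⬝ᵥ x) = w ⬝ᵥ s • x := by rw [dotProduct_smul, smul_eq_mul]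
    _ ≤ w ⬝ᵥ A *ᵥ x := dotProduct_le_dotProduct_of_nonneg_left h hw.nonneg
    _ = r * (w ⬝ᵥ x) := hw.dotProduct_mulVec x

theorem le_of_mulVec_le_smul (hw : IsPosEigenvector Aᵀ r w) (hx : 0 ≤ x) (hx0 : x ≠ 0)
    (h : A *ᵥ x ≤ s • x) : r ≤ s := by
  refine le_of_mul_le_mul_right ?_ (dotProduct_pos_of_pos hw.pos hx hx0)
  calc r * (w ⬝ᵥ x) = w ⬝ᵥ A *ᵥ x := (hw.dotProduct_mulVec x).symm
    _ ≤ w ⬝ᵥ s • x := dotProduct_le_dotProduct_of_nonneg_left h hw.nonneg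
    _ = s * (w ⬝ᵥ x) := by rw [dotProduct_smul, smul_eq_mul]

theorem eigenvalue_eq (hw : IsPosEigenvector Aᵀ r w) (hx : 0 ≤ x) (hx0 : x ≠ 0)
    (h : A *ᵥ x = s • x) : s = r :=
  (hw.le_of_smul_le_mulVec hx hx0 h.ge).antisymm (hw.le_of_mulVec_le_smul hx hx0 h.le)

theorem norm_le_of_mulVec_eq_smul {𝕜 : Type*} [NormedField 𝕜] [NormedAlgebra ℝ 𝕜] {z : 𝕜}
    {y : n → 𝕜} (hw : IsPosEigenvector Aᵀ r w) (hA : ∀ i j, 0 ≤ A i j) (hy : y ≠ 0)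
    (h : A.map (algebraMap ℝ 𝕜) *ᵥ y = z • y) :
    ‖z‖ ≤ r := by
  refine hw.le_of_smul_le_mulVec (x := fun i => ‖y i‖) (fun i => norm_nonneg _)
    (fun h0 => hy (funext fun i => norm_eq_zero.1 (congrFun h0 i))) fun i => ?_
  calc ‖z‖ * ‖y i‖ = ‖∑ j, algebraMap ℝ 𝕜 (A i j) * y j‖ := by
        rw [← norm_mul]; exact congrArg norm (congrFun h i).symm
    _ ≤ ∑ j, ‖algebraMap ℝ 𝕜 (A i j) * y j‖ := norm_sum_le _ _
    _ = ∑ j, A i j * ‖y j‖ := by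
        simp only [norm_mul, norm_algebraMap', Real.norm_of_nonneg (hA i _)]

theorem eigenvalue_nonneg [Nonempty n] (hv : IsPosEigenvector A r v) (hA : ∀ i j, 0 ≤ A i j) :
    0 ≤ r := by
  have h : A *ᵥ 0 ≤ A *ᵥ v := mulVec_mono_of_nonneg hA hv.nonneg
  rw [mulVec_zero, hv.mulVec_eq] at h
  obtain ⟨i⟩ := ‹Nonempty n›
  exact nonneg_of_mul_nonneg_left (h i) (hv.pos i)

theorem exists_pow_mulVec_one_bounds [DecidableEq n] (hv : IsPosEigenvector A r v)
    (hA : ∀ i j, 0 ≤ A i j) : ∃ ε > 0, ∀ k i,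
      ε * r ^ k ≤ (A ^ k *ᵥ 1) i ∧ ε * (A ^ k *ᵥ 1) i ≤ r ^ k := by
  obtain ⟨a, ha, hav⟩ := exists_pos_mul_le v (z := 1) (by simp)
  obtain ⟨b, hb, hbv⟩ := exists_pos_mul_le 1 hv.pos
  refine ⟨a * b, mul_pos ha hb, fun k i => ?_⟩
  have : Nonempty n := ⟨i⟩
  have hrk : 0 ≤ r ^ k := pow_nonneg (hv.eigenvalue_nonneg hA) k
  have hmono := mulVec_mono_of_nonneg (pow_apply_nonneg hA k)
  have hpow : A ^ k *ᵥ v = r ^ k • v := (hv.pow k).mulVec_eq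
  constructor
  · calc a * b * r ^ k ≤ a * v i * r ^ k := by gcongr; simpa using hbv i
      _ = (A ^ k *ᵥ (a • v)) i := by simp [mulVec_smul, hpow]; ring
      _ ≤ (A ^ k *ᵥ 1) i := hmono (show a • v ≤ 1 from hav) i
  · calc a * b * (A ^ k *ᵥ 1) i = a * (A ^ k *ᵥ (b • 1)) i := by simp [mulVec_smul, mul_assoc]
      _ ≤ a * (A ^ k *ᵥ v) i := by gcongr; exact hmono (show b • 1 ≤ v from hbv) i
      _ = r ^ k * (a * v i) := by simp [hpow]; ring
      _ ≤ r ^ k := mul_le_of_le_one_right hrk (hav i)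

end IsPosEigenvector

theorem exists_max_subinvariant [Nonempty n] (hA : ∀ i j, 0 ≤ A i j) :
    ∃ t : ℝ, (∃ x ∈ stdSimplex ℝ n, t • x ≤ A *ᵥ x) ∧
      ∀ (s : ℝ) (x : n → ℝ), 0 ≤ x → x ≠ 0 → s • x ≤ A *ᵥ x → s ≤ t := by
  classical
  have bound : ∀ s : ℝ, ∀ x ∈ stdSimplex ℝ n, s • x ≤ A *ᵥ x → s ≤ ∑ i, ∑ j, A i j :=
    fun s x hx h => by
    calc s = ∑ i, (s • x) i := by simp [← Finset.mul_sum, hx.2]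
      _ ≤ ∑ i, (A *ᵥ x) i := Finset.sum_le_sum fun i _ => h i
      _ ≤ ∑ i, ∑ j, A i j := Finset.sum_le_sum fun i _ => Finset.sum_le_sum fun j _ =>
        mul_le_of_le_one_right (hA i j) (mem_Icc_of_mem_stdSimplex hx j).2
  let S : Set (ℝ × (n → ℝ)) :=
    (Set.Icc 0 (∑ i, ∑ j, A i j) ×ˢ stdSimplex ℝ n) ∩ {q | q.1 • q.2 ≤ A *ᵥ q.2}
  have hS : IsCompact S :=
    (isCompact_Icc.prod (isCompact_stdSimplex ℝ n)).inter_right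
      (isClosed_le (by fun_prop) (by fun_prop))
  obtain ⟨i₀⟩ := ‹Nonempty n›
  have hne : S.Nonempty :=
    ⟨(0, Pi.single i₀ 1), ⟨⟨le_rfl, Finset.sum_nonneg fun i _ => Finset.sum_nonneg fun j _ =>
      hA i j⟩, single_mem_stdSimplex ℝ i₀⟩, fun i => by simp [hA i i₀]⟩
  obtain ⟨⟨t, x⟩, ⟨⟨ht, hx⟩, hle⟩, hmax⟩ := hS.exists_isMaxOn hne continuous_fst.continuousOn
  refine ⟨t, ⟨x, hx, hle⟩, fun s y hy hy0 h => ?_⟩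
  rcases le_total s 0 with hs | hs
  · exact hs.trans ht.1
  obtain ⟨c, hc, hcy⟩ := exists_pos_smul_mem_stdSimplex hy hy0
  have hle' : s • c • y ≤ A *ᵥ (c • y) := by
    rw [mulVec_smul, smul_comm]
    exact smul_le_smul_of_nonneg_left h hc.le
  exact hmax (show (s, c • y) ∈ S from ⟨⟨⟨hs, bound s _ hcy hle'⟩, hcy⟩, hle'⟩)

end PositiveEigenvectors

/-! ### Perron's theorem for primitive matrices -/

section Perron

variable {n : Type*} [Fintype n] [DecidableEq n] {A : Matrix n n ℝ} {r s : ℝ} {v w x : n → ℝ}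

theorem isPrimitive_transpose (hA : A.IsPrimitive) : Aᵀ.IsPrimitive := by
  obtain ⟨N, hN, hpos⟩ := hA.exists_pos_pow
  exact ⟨fun i j => hA.nonneg j i, N, hN, fun i j => by
    rw [← transpose_pow]; exact hpos j i⟩

theorem isPosEigenvector_of_nonneg (hA : A.IsPrimitive) (hx : 0 ≤ x) (hx0 : x ≠ 0)
    (h : A *ᵥ x = r • x) : IsPosEigenvector A r x := by
  obtain ⟨N, -, hpos⟩ := hA.exists_pos_pow
  refine ⟨fun i => (hx i).lt_of_ne' fun hxi => ?_, h⟩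
  simpa [pow_mulVec_of_mulVec_eq_smul h, hxi] using mulVec_pos_of_pos hpos hx hx0 i

theorem IsPosEigenvector.eigenvalue_pos [Nonempty n] (hv : IsPosEigenvector A r v)
    (hA : A.IsPrimitive) : 0 < r := by
  obtain ⟨N, hN, hpos⟩ := hA.exists_pos_pow
  refine (hv.eigenvalue_nonneg hA.nonneg).lt_of_ne' ?_
  rintro rfl
  obtain ⟨i⟩ := ‹Nonempty n›
  simpa [(hv.pow N).mulVec_eq, hN.ne'] using mulVec_pos_of_pos hpos hv.nonneg hv.ne_zero i

theorem exists_isPosEigenvector [Nonempty n] (hA : A.IsPrimitive) :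
    ∃ r : ℝ, ∃ v ∈ stdSimplex ℝ n, IsPosEigenvector A r v := by
  obtain ⟨N, -, hpos⟩ := hA.exists_pos_pow
  obtain ⟨t, ⟨x, hx, hle⟩, hmax⟩ := exists_max_subinvariant hA.nonneg
  have hx0 : x ≠ 0 := ne_zero_of_mem_stdSimplex hx
  suffices h : A *ᵥ x = t • x from ⟨t, x, hx, isPosEigenvector_of_nonneg hA hx.1 hx0 h⟩
  by_contra hne
  -- Otherwise `A ^ N` smooths the slack `A x - t x` into a positive vector, and `t` can be
  -- increased.
  set y := A ^ N *ᵥ x with hy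
  have hypos : ∀ i, 0 < y i := mulVec_pos_of_pos hpos hx.1 hx0
  have hslack : ∀ i, 0 < (A *ᵥ y - t • y) i := by
    have hcomm : A ^ N *ᵥ (A *ᵥ x - t • x) = A *ᵥ y - t • y := by
      rw [mulVec_sub, mulVec_smul, hy, mulVec_mulVec, mulVec_mulVec, ← pow_succ, ← pow_succ']
    rw [← hcomm]
    exact mulVec_pos_of_pos hpos (sub_nonneg.2 hle) (sub_ne_zero.2 hne)
  obtain ⟨ε, hε, hεy⟩ := exists_pos_mul_le y hslack
  have hlarger : (t + ε) • y ≤ A *ᵥ y := by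
    rw [add_smul, add_comm]
    exact le_sub_iff_add_le.1 hεy
  obtain ⟨i⟩ := ‹Nonempty n›
  have hy0 : y ≠ 0 := Function.ne_iff.2 ⟨i, (hypos i).ne'⟩
  linarith [hmax (t + ε) y (fun i => (hypos i).le) hy0 hlarger]

theorem IsPosEigenvector.exists_transpose [Nonempty n] (hv : IsPosEigenvector A r v)
    (hA : A.IsPrimitive) : ∃ w, IsPosEigenvector Aᵀ r w := by
  obtain ⟨s, w, -, hw⟩ := exists_isPosEigenvector (isPrimitive_transpose hA)
  rw [hw.eigenvalue_eq hv.nonneg hv.ne_zero hv.mulVec_eq]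
  exact ⟨w, hw⟩

section Dominance

variable {𝕜 : Type*} [NormedField 𝕜] [NormedAlgebra ℝ 𝕜] {z : 𝕜} {y : n → 𝕜}

theorem IsPosEigenvector.norm_lt_of_dotProduct_eq_zero (hw : IsPosEigenvector Aᵀ r w)
    (hA : A.IsPrimitive) (hy : y ≠ 0) (h : A.map (algebraMap ℝ 𝕜) *ᵥ y = z • y)
    (hwy : (algebraMap ℝ 𝕜 ∘ w) ⬝ᵥ y = 0) : ‖z‖ < r := by
  obtain ⟨N, -, hpos⟩ := hA.exists_pos_pow
  obtain ⟨ε, hε, hεw⟩ := exists_pos_mul_le (fun q : n × n => w q.2) fun q => hpos q.1 q.2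
  obtain ⟨i, -⟩ := Function.ne_iff.1 hy
  have : Nonempty n := ⟨i⟩
  -- Subtracting a multiple of the rank one matrix `1 wᵀ` lowers the Perron root of `A ^ N`, but
  -- does not affect its action on `y`.
  let C : Matrix n n ℝ := vecMulVec (fun _ => ε) w
  have hleft : IsPosEigenvector (A ^ N - C)ᵀ (r ^ N - ε * ∑ i, w i) w := by
    have hpow : w ᵥ* A ^ N = r ^ N • w := by
      rw [← mulVec_transpose, transpose_pow, (hw.pow N).mulVec_eq]
    refine ⟨hw.pos, ?_⟩
    rw [mulVec_transpose, vecMul_sub, hpow, vecMul_vecMulVec, sub_smul]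
    simp [dotProduct, ← Finset.mul_sum, mul_comm]
  have hright : (A ^ N - C).map (algebraMap ℝ 𝕜) *ᵥ y = z ^ N • y := by
    have hpow : (A ^ N).map (algebraMap ℝ 𝕜) = A.map (algebraMap ℝ 𝕜) ^ N := A.map_pow _ N
    have hC : C.map (algebraMap ℝ 𝕜) *ᵥ y = 0 := funext fun i => by
      simp only [dotProduct, Function.comp] at hwy
      simp [C, mulVec, dotProduct, vecMulVec_apply, mul_assoc, ← Finset.mul_sum, hwy]
    rw [Matrix.map_sub _ (map_sub _), sub_mulVec, hpow, hC, sub_zero,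
      pow_mulVec_of_mulVec_eq_smul h]
  have hle : ‖z‖ ^ N ≤ r ^ N - ε * ∑ i, w i := by
    rw [← norm_pow]
    exact hleft.norm_le_of_mulVec_eq_smul (fun i j => sub_nonneg.2 (hεw (i, j))) hy hright
  have hsum : 0 < ∑ i, w i := Finset.sum_pos (fun i _ => hw.pos i) Finset.univ_nonempty
  have hr : 0 ≤ r := (norm_nonneg z).trans (hw.norm_le_of_mulVec_eq_smul hA.nonneg hy h)
  exact lt_of_pow_lt_pow_left₀ N hr (hle.trans_lt (sub_lt_self _ (mul_pos hε hsum)))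

theorem IsPosEigenvector.eq_zero_of_dotProduct_eq_zero (hw : IsPosEigenvector Aᵀ r w)
    (hA : A.IsPrimitive) (h : A.map (algebraMap ℝ 𝕜) *ᵥ y = r • y)
    (hwy : (algebraMap ℝ 𝕜 ∘ w) ⬝ᵥ y = 0) : y = 0 := by
  by_contra hy
  have hlt := hw.norm_lt_of_dotProduct_eq_zero hA (z := algebraMap ℝ 𝕜 r) hy
    (by simpa [algebraMap_smul] using h) hwy
  rw [norm_algebraMap'] at hlt
  exact (Real.le_norm_self r).not_gt hlt

end Dominance

theorem eq_of_mulVec_eq_smul_of_mem_stdSimplex (hA : A.IsPrimitive) (hv : v ∈ stdSimplex ℝ n)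
    (hx : x ∈ stdSimplex ℝ n) (hAv : A *ᵥ v = r • v) (hAx : A *ᵥ x = s • x) : v = x := by
  have hv0 := ne_zero_of_mem_stdSimplex hv
  obtain ⟨i, -⟩ := Function.ne_iff.1 hv0
  have : Nonempty n := ⟨i⟩
  obtain ⟨w, hw⟩ := (isPosEigenvector_of_nonneg hA hv.1 hv0 hAv).exists_transpose hA
  obtain rfl : s = r := hw.eigenvalue_eq hx.1 (ne_zero_of_mem_stdSimplex hx) hAx
  have hzero : (w ⬝ᵥ x) • v - (w ⬝ᵥ v) • x = 0 := by
    refine hw.eq_zero_of_dotProduct_eq_zero hA (𝕜 := ℝ) ?_ ?_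
    · simp [mulVec_sub, mulVec_smul, hAv, hAx, smul_sub, smul_comm s]
    · change w ⬝ᵥ ((w ⬝ᵥ x) • v - (w ⬝ᵥ v) • x) = 0
      simp [dotProduct_sub, mul_comm]
  have hsmul : (w ⬝ᵥ x) • v = (w ⬝ᵥ v) • x := sub_eq_zero.1 hzero
  have hcoef : w ⬝ᵥ x = w ⬝ᵥ v := by
    simpa [← Finset.mul_sum, hv.2, hx.2] using congrArg (fun y : n → ℝ => ∑ i, y i) hsmul
  rw [hcoef] at hsmul
  exact smul_right_injective _ (dotProduct_pos_of_pos hw.pos hv.1 hv0).ne' hsmul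

end Perron

theorem finrank_maxGenEigenspace_eq_one {F V : Type*} [Field F] [AddCommGroup V] [Module F V]
    {f : Module.End F V} {φ : Module.Dual F V} {r : F} {v : V} (hφ : ∀ x, φ (f x) = r * φ x)
    (hfv : f v = r • v) (hφv : φ v ≠ 0) (hker : ∀ x, φ x = 0 → f x = r • x → x = 0) :
    Module.finrank F (f.maxGenEigenspace r) = 1 := by
  let g : Module.End F V := f - algebraMap F (Module.End F V) r
  have hg : ∀ x, g x = f x - r • x := fun x => rfl
  have hinj : ∀ k : ℕ, Set.InjOn (⇑(g ^ k)) {x | φ x = 0} := fun k => by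
    rw [Module.End.coe_pow]
    refine Set.InjOn.iterate (fun x hx y hy hxy => ?_) (fun x hx => ?_) k
    · refine sub_eq_zero.1 (hker (x - y) (by simp_all) ?_)
      rw [← sub_eq_zero, ← hg, map_sub, hxy, sub_self]
    · simp_all
  have hmem : v ∈ f.maxGenEigenspace r :=
    (Module.End.mem_maxGenEigenspace f r v).2 ⟨1, by simp [hfv]⟩
  have hspan : f.maxGenEigenspace r = F ∙ v := by
    refine le_antisymm (fun x hx => ?_) ((Submodule.span_singleton_le_iff_mem _ _).2 hmem)
    have hφx : φ (x - (φ x / φ v) • v) = 0 := by simp [hφv]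
    obtain ⟨k, hk⟩ := (Module.End.mem_maxGenEigenspace f r _).1
      (Submodule.sub_mem _ hx (Submodule.smul_mem _ (φ x / φ v) hmem))
    have hzero : x - (φ x / φ v) • v = 0 :=
      hinj k hφx (map_zero φ) (hk.trans (map_zero (g ^ k)).symm)
    exact Submodule.mem_span_singleton.2 ⟨_, (sub_eq_zero.1 hzero).symm⟩
  rw [hspan, finrank_span_singleton (by rintro rfl; simp at hφv)]

theorem IsPosEigenvector.isMaxModulusEigenvalue {K : ℕ} [NeZero K]
    {A : Matrix (Fin K) (Fin K) ℝ} {r : ℝ} {v : Fin K → ℝ} (hv : IsPosEigenvector A r v)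
    (hA : A.IsPrimitive) : IsMaxModulusEigenvalue A r := by
  obtain ⟨w, hw⟩ := hv.exists_transpose hA
  let ι : ℝ →+* ℂ := algebraMap ℝ ℂ
  let f : Module.End ℂ (Fin K → ℂ) := Matrix.toLin' (A.map ι)
  let φ : Module.Dual ℂ (Fin K → ℂ) := dotProductBilin ℂ ℂ (ι ∘ w)
  have hφ : ∀ y, φ (f y) = r * φ y := fun y => by
    have hleft : (ι ∘ w) ᵥ* A.map ι = ι r • (ι ∘ w) := by
      rw [← mulVec_transpose, ← transpose_map, hw.map_mulVec_eq]
    calc (ι ∘ w) ⬝ᵥ A.map ι *ᵥ y = (ι r • (ι ∘ w)) ⬝ᵥ y := by rw [Matrix.dotProduct_mulVec, hleft]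
      _ = r * ((ι ∘ w) ⬝ᵥ y) := smul_dotProduct _ _ _
  have hφv : φ (ι ∘ v) ≠ 0 := by
    change (ι ∘ w) ⬝ᵥ (ι ∘ v) ≠ 0
    rw [← RingHom.map_dotProduct]
    exact (map_ne_zero ι).2 (dotProduct_pos_of_pos hw.pos hv.nonneg hv.ne_zero).ne'
  have hchar : (A.map Complex.ofReal).charpoly = f.charpoly := (Matrix.charpoly_toLin' _).symm
  refine ⟨?_, fun z hz hne => ?_⟩
  · rw [hchar, ← LinearMap.finrank_maxGenEigenspace_eq]
    exact finrank_maxGenEigenspace_eq_one hφ (hv.map_mulVec_eq ι) hφv fun y hφy hfy =>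
      hw.eq_zero_of_dotProduct_eq_zero hA hfy hφy
  · rw [hchar, ← Module.End.hasEigenvalue_iff_isRoot_charpoly] at hz
    obtain ⟨y, hy⟩ := hz.exists_hasEigenvector
    have hfy : f y = z • y := hy.apply_eq_smul
    have hφy : z * φ y = r * φ y := by rw [← hφ, hfy, map_smul, smul_eq_mul]
    rw [abs_of_pos (hv.eigenvalue_pos hA)]
    exact hw.norm_lt_of_dotProduct_eq_zero hA hy.2 hfy
      ((mul_eq_mul_right_iff.1 hφy).resolve_left hne)

/-! ### Dependence of the Perron root on the matrix -/

section Families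

variable {n : Type*} [Fintype n]

theorem tendsto_mulVec {X : Type*} {l : Filter X} {A : X → Matrix n n ℝ} {B : Matrix n n ℝ}
    {V : X → n → ℝ} {x : n → ℝ} (hA : Tendsto A l (𝓝 B)) (hV : Tendsto V l (𝓝 x)) :
    Tendsto (fun y => A y *ᵥ V y) l (𝓝 (B *ᵥ x)) :=
  ((continuous_fst.matrix_mulVec continuous_snd).tendsto (B, x)).comp (hA.prodMk_nhds hV)

theorem continuousAt_eigenvector [DecidableEq n] {X : Type*} [TopologicalSpace X]
    {A : X → Matrix n n ℝ} {r : X → ℝ} {V : X → n → ℝ} {a : X} (hA : (A a).IsPrimitive)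
    (hcont : ContinuousAt A a) (hV : ∀ y, V y ∈ stdSimplex ℝ n)
    (hAV : ∀ y, A y *ᵥ V y = r y • V y) : ContinuousAt V a := by
  refine (isCompact_stdSimplex ℝ n).tendsto_nhds_of_unique_mapClusterPt
    (Eventually.of_forall hV) fun x hx hcluster => ?_
  obtain ⟨U, hU, hVU⟩ := mapClusterPt_iff_ultrafilter.1 hcluster
  have hAVU : Tendsto (fun y => A y *ᵥ V y) U (𝓝 (A a *ᵥ x)) :=
    tendsto_mulVec (hcont.mono_left hU) hVU
  have hr : ∀ y, r y = ∑ i, (A y *ᵥ V y) i := fun y => by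
    simp [hAV, ← Finset.mul_sum, (hV y).2]
  have hrU : Tendsto r U (𝓝 (∑ i, (A a *ᵥ x) i)) := by
    rw [funext hr]
    exact tendsto_finsetSum _ fun i _ => tendsto_pi_nhds.1 hAVU i
  have hAx : A a *ᵥ x = (∑ i, (A a *ᵥ x) i) • x :=
    tendsto_nhds_unique hAVU (by simpa only [hAV] using hrU.smul hVU)
  exact (eq_of_mulVec_eq_smul_of_mem_stdSimplex hA (hV a) hx (hAV a) hAx).symm

theorem hasDerivAt_eigenvalue [DecidableEq n] {A : ℝ → Matrix n n ℝ} {A' : Matrix n n ℝ}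
    {r : ℝ → ℝ} {V : ℝ → n → ℝ} {w : n → ℝ} {θ : ℝ} (hA : (A θ).IsPrimitive)
    (hA' : ∀ i j, HasDerivAt (fun φ => A φ i j) (A' i j) θ) (hV : ∀ φ, V φ ∈ stdSimplex ℝ n)
    (hAV : ∀ φ, A φ *ᵥ V φ = r φ • V φ) (hw : IsPosEigenvector (A θ)ᵀ (r θ) w) :
    HasDerivAt r ((w ⬝ᵥ A' *ᵥ V θ) / (w ⬝ᵥ V θ)) θ := by
  have hwV : ∀ φ, 0 < w ⬝ᵥ V φ := fun φ =>
    dotProduct_pos_of_pos hw.pos (hV φ).1 (ne_zero_of_mem_stdSimplex (hV φ))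
  have hcont : ContinuousAt A θ :=
    tendsto_pi_nhds.2 fun i => tendsto_pi_nhds.2 fun j => (hA' i j).continuousAt
  have hVθ : Tendsto V (𝓝[≠] θ) (𝓝 (V θ)) :=
    (continuousAt_eigenvector hA hcont hV hAV).mono_left nhdsWithin_le_nhds
  let D : ℝ → Matrix n n ℝ := fun φ => (φ - θ)⁻¹ • (A φ - A θ)
  have hD : Tendsto D (𝓝[≠] θ) (𝓝 A') :=
    tendsto_pi_nhds.2 fun i => tendsto_pi_nhds.2 fun j => (hA' i j).tendsto_slope
  have hslope : ∀ φ, slope r θ φ = (w ⬝ᵥ D φ *ᵥ V φ) / (w ⬝ᵥ V φ) := fun φ => by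
    rw [eq_div_iff (hwV φ).ne', smul_mulVec, sub_mulVec, dotProduct_smul, dotProduct_sub,
      hw.dotProduct_mulVec, hAV, dotProduct_smul, slope_def_field]
    simp only [smul_eq_mul]
    ring
  have hpair : ∀ {V' : ℝ → n → ℝ} {x : n → ℝ}, Tendsto V' (𝓝[≠] θ) (𝓝 x) →
      Tendsto (fun φ => w ⬝ᵥ V' φ) (𝓝[≠] θ) (𝓝 (w ⬝ᵥ x)) := fun hV' =>
    ((continuous_const.dotProduct continuous_id).tendsto _).comp hV'
  rw [hasDerivAt_iff_tendsto_slope, funext hslope]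
  exact (hpair (tendsto_mulVec hD hVθ)).div (hpair hVθ) (hwV θ).ne'

theorem sum_rpow_mul_rpow_le {ι : Type*} (t : Finset ι) {x y : ι → ℝ} {a b : ℝ}
    (hx : ∀ i, 0 ≤ x i) (hy : ∀ i, 0 ≤ y i) (ha : 0 < a) (hb : 0 < b) (hab : a + b = 1) :
    ∑ i ∈ t, x i ^ a * y i ^ b ≤ (∑ i ∈ t, x i) ^ a * (∑ i ∈ t, y i) ^ b := by
  simpa [Real.rpow_rpow_inv, hx, hy, ha.ne', hb.ne'] using
    Real.inner_le_Lp_mul_Lq_of_nonneg t (Real.HolderConjugate.inv_inv ha hb hab)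
      (fun i _ => Real.rpow_nonneg (hx i) a) fun i _ => Real.rpow_nonneg (hy i) b

theorem eigenvalue_le_rpow_mul_rpow [Nonempty n] {A B C : Matrix n n ℝ} {r s t a b : ℝ}
    {v u w : n → ℝ} (ha : 0 < a) (hb : 0 < b) (hab : a + b = 1) (hA : ∀ i j, 0 ≤ A i j)
    (hB : ∀ i j, 0 ≤ B i j) (hC : ∀ i j, C i j ≤ A i j ^ a * B i j ^ b)
    (hv : IsPosEigenvector A r v) (hu : IsPosEigenvector B s u) (hw : IsPosEigenvector Cᵀ t w) :
    t ≤ r ^ a * s ^ b := by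
  have hr := hv.eigenvalue_nonneg hA
  have hs := hu.eigenvalue_nonneg hB
  let x : n → ℝ := fun i => v i ^ a * u i ^ b
  have hx : ∀ i, 0 < x i := fun i =>
    mul_pos (Real.rpow_pos_of_pos (hv.pos i) a) (Real.rpow_pos_of_pos (hu.pos i) b)
  obtain ⟨i₀⟩ := ‹Nonempty n›
  refine hw.le_of_mulVec_le_smul (fun i => (hx i).le) (Function.ne_iff.2 ⟨i₀, (hx i₀).ne'⟩)
    fun i => ?_
  calc ∑ j, C i j * x j ≤ ∑ j, A i j ^ a * B i j ^ b * x j :=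
        Finset.sum_le_sum fun j _ => mul_le_mul_of_nonneg_right (hC i j) (hx j).le
    _ = ∑ j, (A i j * v j) ^ a * (B i j * u j) ^ b := Finset.sum_congr rfl fun j _ => by
        rw [Real.mul_rpow (hA i j) (hv.nonneg j), Real.mul_rpow (hB i j) (hu.nonneg j)]
        ring
    _ ≤ ((A *ᵥ v) i) ^ a * ((B *ᵥ u) i) ^ b := sum_rpow_mul_rpow_le _
        (fun j => mul_nonneg (hA i j) (hv.nonneg j)) (fun j => mul_nonneg (hB i j) (hu.nonneg j))
        ha hb hab
    _ = r ^ a * s ^ b * x i := by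
        rw [hv.mulVec_eq, hu.mulVec_eq, Pi.smul_apply, Pi.smul_apply, smul_eq_mul, smul_eq_mul,
          Real.mul_rpow hr (hv.nonneg i), Real.mul_rpow hs (hu.nonneg i)]
        ring

end Families

/-! ### Primitivity of aperiodic irreducible matrices -/

section Primitivity

variable {n : Type*} [Fintype n] [DecidableEq n] {A B : Matrix n n ℝ}

theorem pow_add_apply_pos (hA : ∀ i j, 0 ≤ A i j) {a b : ℕ} {i j k : n} (hij : 0 < (A ^ a) i j)
    (hjk : 0 < (A ^ b) j k) : 0 < (A ^ (a + b)) i k := by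
  rw [pow_add, mul_apply]
  exact Finset.sum_pos'
    (fun l _ => mul_nonneg (pow_apply_nonneg hA a i l) (pow_apply_nonneg hA b l k))
    ⟨j, Finset.mem_univ j, mul_pos hij hjk⟩

theorem pow_apply_pos_of_forall_pos_imp_pos (hA : ∀ i j, 0 ≤ A i j) (hB : ∀ i j, 0 ≤ B i j)
    (h : ∀ i j, 0 < A i j → 0 < B i j) {k : ℕ} {i j : n} (hk : 0 < (A ^ k) i j) :
    0 < (B ^ k) i j := by
  induction k generalizing j with
  | zero => simpa using hk
  | succ k ih =>
    rw [pow_succ, mul_apply] at hk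
    obtain ⟨l, -, hl⟩ := Finset.exists_lt_of_sum_lt (f := fun _ => (0 : ℝ)) (by simpa using hk)
    have hil : 0 < (A ^ k) i l := pos_of_mul_pos_left hl (hA l j)
    refine pow_add_apply_pos hB (ih hil) ?_
    simpa using h l j (pos_of_mul_pos_right hl hil.le)

theorem isPrimitive_of_forall_pos_imp_pos (hA : A.IsPrimitive) (hB : ∀ i j, 0 ≤ B i j)
    (h : ∀ i j, 0 < A i j → 0 < B i j) : B.IsPrimitive := by
  obtain ⟨N, hN, hpos⟩ := hA.exists_pos_pow
  exact ⟨hB, N, hN, fun i j => pow_apply_pos_of_forall_pos_imp_pos hA.nonneg hB h (hpos i j)⟩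

theorem exists_apply_pos_of_isPrimitive (hA : A.IsPrimitive) (i : n) : ∃ j, 0 < A i j := by
  obtain ⟨N, hN, hpos⟩ := hA.exists_pos_pow
  by_contra! hrow
  refine (hpos i i).not_ge ?_
  rw [← Nat.succ_pred_eq_of_pos hN, pow_succ', mul_apply]
  exact Finset.sum_nonpos fun j _ =>
    mul_nonpos_of_nonpos_of_nonneg (hrow j) (pow_apply_nonneg hA.nonneg _ j i)

theorem eventually_pow_apply_self_pos (hA : ∀ i j, 0 ≤ A i j) {i : n}
    (hi : Nat.setGcd {m : ℕ | 0 < m ∧ 0 < (A ^ m) i i} = 1) :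
    ∀ᶠ m in atTop, 0 < (A ^ m) i i := by
  obtain ⟨N, hN⟩ := Nat.exists_mem_closure_of_ge {m : ℕ | 0 < m ∧ 0 < (A ^ m) i i}
  filter_upwards [eventually_ge_atTop N] with m hm
  have hmem := hN m hm (hi ▸ one_dvd m)
  clear hm
  induction hmem using AddSubmonoid.closure_induction with
  | mem x hx => exact hx.2
  | zero => simp
  | add x y _ _ hx hy => exact pow_add_apply_pos hA hx hy

theorem isPrimitive_of_isIrreducible_of_isAperiodic {K : ℕ} {p : Matrix (Fin K) (Fin K) ℝ}
    (hirr : p.IsIrreducible) (haper : IsAperiodic p) : p.IsPrimitive := by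
  have hpos : ∀ i j, ∀ᶠ m in atTop, 0 < (p ^ m) i j := fun i j => by
    obtain ⟨d, -, hd⟩ := (isIrreducible_iff_exists_pow_pos hirr.nonneg).1 hirr i j
    rw [← map_add_atTop_eq_nat d]
    exact eventually_map.2 <| (eventually_pow_apply_self_pos hirr.nonneg (haper i)).mono fun m hm =>
      pow_add_apply_pos hirr.nonneg hm hd
  obtain ⟨N, hN, h⟩ := ((eventually_gt_atTop 0).and
    (eventually_all.2 fun i => eventually_all.2 (hpos i))).exists
  exact ⟨hirr.nonneg, N, hN, h⟩

end Primitivity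

/-! ### The matrices `A(θ)` and their pressure -/

/-- The power `s ^ θ` with the convention `0 ^ θ = 0` for every `θ` (while `Real.rpow` has
`0 ^ 0 = 1`), so that `powMatrix p θ i j = truncRpow (p i j) θ`. -/
noncomputable def truncRpow (s θ : ℝ) : ℝ := if s = 0 then 0 else s ^ θ

section TruncRpow

variable {s : ℝ}

theorem truncRpow_zero_left (θ : ℝ) : truncRpow 0 θ = 0 := if_pos rfl

theorem truncRpow_of_pos (hs : 0 < s) (θ : ℝ) : truncRpow s θ = s ^ θ := if_neg hs.ne'

theorem truncRpow_pos (hs : 0 < s) (θ : ℝ) : 0 < truncRpow s θ := by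
  rw [truncRpow_of_pos hs]
  exact Real.rpow_pos_of_pos hs θ

theorem truncRpow_one (s : ℝ) : truncRpow s 1 = s := by
  simp +contextual [truncRpow, eq_comm]

theorem truncRpow_nonneg (hs : 0 ≤ s) (θ : ℝ) : 0 ≤ truncRpow s θ := by
  rcases hs.eq_or_lt' with rfl | hs
  exacts [(truncRpow_zero_left θ).ge, (truncRpow_pos hs θ).le]

theorem truncRpow_mul {t : ℝ} (hs : 0 ≤ s) (ht : 0 ≤ t) (θ : ℝ) :
    truncRpow (s * t) θ = truncRpow s θ * truncRpow t θ := by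
  rcases hs.eq_or_lt' with rfl | hs
  · simp [truncRpow_zero_left]
  rcases ht.eq_or_lt' with rfl | ht
  · simp [truncRpow_zero_left]
  rw [truncRpow_of_pos hs, truncRpow_of_pos ht, truncRpow_of_pos (mul_pos hs ht),
    Real.mul_rpow hs.le ht.le]

theorem truncRpow_add (hs : 0 ≤ s) (θ φ : ℝ) :
    truncRpow s (θ + φ) = truncRpow s θ * truncRpow s φ := by
  rcases hs.eq_or_lt' with rfl | hs
  · simp [truncRpow_zero_left]
  simp only [truncRpow_of_pos hs, Real.rpow_add hs]

theorem truncRpow_mul_add_mul (hs : 0 ≤ s) {a b : ℝ} (ha : 0 < a) (θ φ : ℝ) :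
    truncRpow s (a * θ + b * φ) = truncRpow s θ ^ a * truncRpow s φ ^ b := by
  rcases hs.eq_or_lt' with rfl | hs
  · simp [truncRpow_zero_left, Real.zero_rpow ha.ne']
  simp only [truncRpow_of_pos hs, Real.rpow_add hs, mul_comm a, mul_comm b, Real.rpow_mul hs.le]

theorem hasDerivAt_truncRpow (hs : 0 ≤ s) (θ : ℝ) :
    HasDerivAt (truncRpow s) (truncRpow s θ * Real.log s) θ := by
  rcases hs.eq_or_lt' with rfl | hs
  · simpa [funext truncRpow_zero_left] using hasDerivAt_const θ (0 : ℝ)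
  · simpa [funext (truncRpow_of_pos hs), mul_comm] using (hasDerivAt_id θ).const_rpow hs

end TruncRpow

variable {K : ℕ} {p : Matrix (Fin K) (Fin K) ℝ}

theorem powMatrix_apply (p : Matrix (Fin K) (Fin K) ℝ) (θ : ℝ) (i j : Fin K) :
    powMatrix p θ i j = truncRpow (p i j) θ := rfl

theorem powMatrix_one (p : Matrix (Fin K) (Fin K) ℝ) : powMatrix p 1 = p := by
  ext i j
  exact truncRpow_one (p i j)

theorem powMatrix_nonneg (hp : ∀ i j, 0 ≤ p i j) (θ : ℝ) (i j : Fin K) : 0 ≤ powMatrix p θ i j :=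
  truncRpow_nonneg (hp i j) θ

theorem isPrimitive_powMatrix (hp : p.IsPrimitive) (θ : ℝ) : (powMatrix p θ).IsPrimitive :=
  isPrimitive_of_forall_pos_imp_pos hp (powMatrix_nonneg hp.nonneg θ) fun _ _ h =>
    truncRpow_pos h θ

section Rho

variable [NeZero K]

theorem exists_rho_eigenvector (hp : p.IsPrimitive) (θ : ℝ) :
    ∃ v ∈ stdSimplex ℝ (Fin K), IsPosEigenvector (powMatrix p θ) (rho p θ) v := by
  obtain ⟨r, v, hv, hAv⟩ := exists_isPosEigenvector (isPrimitive_powMatrix hp θ)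
  have hr : rho p θ = r :=
    (hAv.isMaxModulusEigenvalue (isPrimitive_powMatrix hp θ)).eq_maxModulusEigenvalue
  exact ⟨v, hv, hr ▸ hAv⟩

theorem isMaxModulusEigenvalue_rho (hp : p.IsPrimitive) (θ : ℝ) :
    IsMaxModulusEigenvalue (powMatrix p θ) (rho p θ) := by
  obtain ⟨v, -, hv⟩ := exists_rho_eigenvector hp θ
  exact hv.isMaxModulusEigenvalue (isPrimitive_powMatrix hp θ)

theorem rho_pos (hp : p.IsPrimitive) (θ : ℝ) : 0 < rho p θ := by
  obtain ⟨v, -, hv⟩ := exists_rho_eigenvector hp θ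
  exact hv.eigenvalue_pos (isPrimitive_powMatrix hp θ)

theorem differentiable_rho (hp : p.IsPrimitive) : Differentiable ℝ (rho p) := fun θ => by
  choose V hV hAV using exists_rho_eigenvector hp
  obtain ⟨w, hw⟩ := (hAV θ).exists_transpose (isPrimitive_powMatrix hp θ)
  exact (hasDerivAt_eigenvalue (A' := of fun i j => powMatrix p θ i j * Real.log (p i j))
    (isPrimitive_powMatrix hp θ) (fun i j => hasDerivAt_truncRpow (hp.nonneg i j) θ) hV
    (fun φ => (hAV φ).mulVec_eq) hw).differentiableAt

end Rho

/-- The pressure `log ρ(θ)`, whose derivative `ρ'(θ) / ρ(θ)` interpolates between the exponential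
growth rates of the smallest and of the largest box. -/
noncomputable def pressure (p : Matrix (Fin K) (Fin K) ℝ) (θ : ℝ) : ℝ := Real.log (rho p θ)

section Pressure

variable [NeZero K]

theorem hasDerivAt_pressure (hp : p.IsPrimitive) (θ : ℝ) :
    HasDerivAt (pressure p) (deriv (rho p) θ / rho p θ) θ :=
  (differentiable_rho hp θ).hasDerivAt.log (rho_pos hp θ).ne'

theorem differentiable_pressure (hp : p.IsPrimitive) : Differentiable ℝ (pressure p) :=
  fun θ => (hasDerivAt_pressure hp θ).differentiableAt

theorem exp_natCast_mul_pressure (hp : p.IsPrimitive) (n : ℕ) (θ : ℝ) :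
    Real.exp (n * pressure p θ) = rho p θ ^ n := by
  rw [pressure, Real.exp_nat_mul, Real.exp_log (rho_pos hp θ)]

theorem convexOn_pressure (hp : p.IsPrimitive) : ConvexOn ℝ Set.univ (pressure p) := by
  refine convexOn_iff_forall_pos.2 ⟨convex_univ, fun θ _ φ _ a b ha hb hab => ?_⟩
  obtain ⟨v, -, hv⟩ := exists_rho_eigenvector hp θ
  obtain ⟨u, -, hu⟩ := exists_rho_eigenvector hp φ
  obtain ⟨x, -, hx⟩ := exists_rho_eigenvector hp (a * θ + b * φ)
  obtain ⟨w, hw⟩ := hx.exists_transpose (isPrimitive_powMatrix hp _)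
  have hle : rho p (a * θ + b * φ) ≤ rho p θ ^ a * rho p φ ^ b :=
    eigenvalue_le_rpow_mul_rpow ha hb hab (powMatrix_nonneg hp.nonneg θ)
      (powMatrix_nonneg hp.nonneg φ)
      (fun i j => (truncRpow_mul_add_mul (hp.nonneg i j) ha θ φ).le) hv hu hw
  have hθ := rho_pos hp θ
  have hφ := rho_pos hp φ
  calc pressure p (a * θ + b * φ) ≤ Real.log (rho p θ ^ a * rho p φ ^ b) :=
        Real.log_le_log (rho_pos hp _) hle
    _ = a * pressure p θ + b * pressure p φ := by
        rw [Real.log_mul (Real.rpow_pos_of_pos hθ a).ne' (Real.rpow_pos_of_pos hφ b).ne',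
          Real.log_rpow hθ, Real.log_rpow hφ, pressure, pressure]

end Pressure

/-! ### Box sizes and powers of `A(θ)` -/

theorem boxSize_nonneg (hp : ∀ i j, 0 ≤ p i j) (i : Fin K) {n : ℕ} (u : Fin n → Fin K) :
    0 ≤ boxSize p i u := by
  induction n with
  | zero => exact zero_le_one
  | succ n ih => exact mul_nonneg (ih _) (hp _ _)

theorem powMatrix_pow_mulVec_apply (hp : ∀ i j, 0 ≤ p i j) (θ : ℝ) (n : ℕ) (x : Fin K → ℝ)
    (i : Fin K) : (powMatrix p θ ^ n *ᵥ x) i =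
      ∑ u : Fin n → Fin K, truncRpow (boxSize p i u) θ * x (boxType i u) := by
  induction n generalizing x with
  | zero => simp [boxSize, boxType, truncRpow]
  | succ n ih =>
    rw [pow_succ, ← mulVec_mulVec, ih, ← (Fin.snocEquiv fun _ : Fin (n + 1) => Fin K).sum_comp,
      Fintype.sum_prod_type, Finset.sum_comm]
    refine Finset.sum_congr rfl fun u _ => ?_
    simp only [mulVec, dotProduct, Finset.mul_sum]
    refine Finset.sum_congr rfl fun k _ => ?_
    have htype : boxType i (Fin.snoc u k : Fin (n + 1) → Fin K) = k := by simp [boxType]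
    change _ = truncRpow (boxSize p i (Fin.snoc u k : Fin (n + 1) → Fin K)) θ *
      x (boxType i (Fin.snoc u k : Fin (n + 1) → Fin K))
    rw [boxSize_snoc, htype, truncRpow_mul (boxSize_nonneg hp i u) (hp _ _), powMatrix_apply,
      mul_assoc]

theorem truncRpow_boxSize_mul_le (hp : ∀ i j, 0 ≤ p i j) (θ : ℝ) {x : Fin K → ℝ} (hx : 0 ≤ x)
    (i : Fin K) {n : ℕ} (u : Fin n → Fin K) :
    truncRpow (boxSize p i u) θ * x (boxType i u) ≤ (powMatrix p θ ^ n *ᵥ x) i := by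
  rw [powMatrix_pow_mulVec_apply hp]
  exact Finset.single_le_sum
    (f := fun u : Fin n → Fin K => truncRpow (boxSize p i u) θ * x (boxType i u))
    (fun u _ => mul_nonneg (truncRpow_nonneg (boxSize_nonneg hp i u) θ) (hx _))
    (Finset.mem_univ u)

theorem rpow_le_powMatrix_pow_mulVec_one (hp : ∀ i j, 0 ≤ p i j) (θ : ℝ) {n : ℕ} {i : Fin K}
    {s : ℝ} (hs : s ∈ boxSizes p i n) : s ^ θ ≤ (powMatrix p θ ^ n *ᵥ 1) i := by
  obtain ⟨hs0, u, rfl⟩ := hs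
  simpa [truncRpow_of_pos hs0] using truncRpow_boxSize_mul_le hp θ zero_le_one i u

theorem powMatrix_add_pow_mulVec_apply_le (hp : ∀ i j, 0 ≤ p i j) {θ h M : ℝ} {n : ℕ}
    {i : Fin K} (hM : ∀ s ∈ boxSizes p i n, s ^ h ≤ M) {x : Fin K → ℝ} (hx : 0 ≤ x) :
    (powMatrix p (θ + h) ^ n *ᵥ x) i ≤ M * (powMatrix p θ ^ n *ᵥ x) i := by
  rw [powMatrix_pow_mulVec_apply hp, powMatrix_pow_mulVec_apply hp, Finset.mul_sum]
  refine Finset.sum_le_sum fun u _ => ?_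
  rw [← mul_assoc]
  refine mul_le_mul_of_nonneg_right ?_ (hx _)
  have hu := boxSize_nonneg hp i u
  rw [truncRpow_add hu, mul_comm]
  rcases hu.eq_or_lt' with h0 | hpos
  · simp [h0, truncRpow_zero_left]
  · rw [truncRpow_of_pos hpos h]
    exact mul_le_mul_of_nonneg_right (hM _ ⟨hpos, u, rfl⟩) (truncRpow_nonneg hu θ)

theorem boxSize_le_pow_apply (hp : ∀ i j, 0 ≤ p i j) (i : Fin K) {n : ℕ} (u : Fin n → Fin K) :
    boxSize p i u ≤ (p ^ n) i (boxType i u) := by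
  simpa [truncRpow_one, powMatrix_one] using
    truncRpow_boxSize_mul_le hp 1 (Pi.single_nonneg.2 zero_le_one) i u
      (x := Pi.single (boxType i u) 1)

theorem finite_boxSizes (p : Matrix (Fin K) (Fin K) ℝ) (i : Fin K) (n : ℕ) :
    (boxSizes p i n).Finite :=
  (Set.finite_range fun u : Fin n → Fin K => boxSize p i u).subset fun _ hx => hx.2

theorem nonempty_boxSizes (hrow : ∀ i, ∃ j, 0 < p i j) (i : Fin K) (n : ℕ) :
    (boxSizes p i n).Nonempty := by
  suffices h : ∃ u : Fin n → Fin K, 0 < boxSize p i u from h.imp' _ fun u hu => ⟨hu, u, rfl⟩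
  induction n with
  | zero => exact ⟨Fin.elim0, zero_lt_one⟩
  | succ n ih =>
    obtain ⟨u, hu⟩ := ih
    obtain ⟨k, hk⟩ := hrow (boxType i u)
    exact ⟨Fin.snoc u k, boxSize_snoc p i u k ▸ mul_pos hu hk⟩

theorem isLeast_smallestBox (hrow : ∀ i, ∃ j, 0 < p i j) (i : Fin K) (n : ℕ) :
    IsLeast (boxSizes p i n) (smallestBox p i n) :=
  ⟨(nonempty_boxSizes hrow i n).csInf_mem (finite_boxSizes p i n),
    fun _ hx => csInf_le (finite_boxSizes p i n).bddBelow hx⟩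

theorem isGreatest_largestBox (hrow : ∀ i, ∃ j, 0 < p i j) (i : Fin K) (n : ℕ) :
    IsGreatest (boxSizes p i n) (largestBox p i n) :=
  ⟨(nonempty_boxSizes hrow i n).csSup_mem (finite_boxSizes p i n),
    fun _ hx => le_csSup (finite_boxSizes p i n).bddAbove hx⟩

theorem apply_lt_one_of_mem_rowStochastic {ι : Type*} [Fintype ι] [DecidableEq ι] [Nontrivial ι]
    {q : Matrix ι ι ℝ} (hq : q ∈ rowStochastic ℝ ι) (hpos : ∀ i j, 0 < q i j) (i j : ι) :
    q i j < 1 := by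
  obtain ⟨k, hk⟩ := exists_ne j
  rw [← sum_row_of_mem_rowStochastic hq i]
  exact Finset.single_lt_sum hk (Finset.mem_univ j) (Finset.mem_univ k) (hpos i k)
    fun l _ _ => (hpos i l).le

theorem exists_boxSizes_subset_Icc [NeZero K] (hp : ∀ i j, 0 ≤ p i j)
    (hrow : ∀ i, ∃ j, 0 < p i j) {n : ℕ} (hlt : ∀ i j, (p ^ n) i j < 1) :
    ∃ a > 0, ∃ b < 1, ∀ i, boxSizes p i n ⊆ Set.Icc a b := by
  obtain ⟨j, hj⟩ := Finite.exists_min fun i => smallestBox p i n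
  obtain ⟨k, hk⟩ := Finite.exists_max fun i => largestBox p i n
  obtain ⟨-, u, hu⟩ := (isGreatest_largestBox hrow k n).1
  exact ⟨_, (isLeast_smallestBox hrow j n).1.1, _,
    hu ▸ (boxSize_le_pow_apply hp k u).trans_lt (hlt k _), fun i s hs =>
    ⟨(hj i).trans ((isLeast_smallestBox hrow i n).2 hs),
      ((isGreatest_largestBox hrow i n).2 hs).trans (hk i)⟩⟩

section BoxPressure

variable [NeZero K]

theorem natCast_mul_pressure_sub_le (hp : p.IsPrimitive) {θ h M : ℝ} {n : ℕ}
    (hM : ∀ i, ∀ s ∈ boxSizes p i n, s ^ h ≤ M) :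
    n * (pressure p (θ + h) - pressure p θ) ≤ Real.log M := by
  obtain ⟨v, -, hv⟩ := exists_rho_eigenvector hp θ
  obtain ⟨u, -, hu⟩ := exists_rho_eigenvector hp (θ + h)
  obtain ⟨w, hw⟩ := hu.exists_transpose (isPrimitive_powMatrix hp _)
  have hwn : IsPosEigenvector (powMatrix p (θ + h) ^ n)ᵀ (rho p (θ + h) ^ n) w := by
    rw [transpose_pow]
    exact hw.pow n
  have hle : rho p (θ + h) ^ n ≤ M * rho p θ ^ n :=
    hwn.le_of_mulVec_le_smul hv.nonneg hv.ne_zero fun i => by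
      refine (powMatrix_add_pow_mulVec_apply_le hp.nonneg (hM i) hv.nonneg).trans_eq ?_
      simp only [(hv.pow n).mulVec_eq, Pi.smul_apply, smul_eq_mul, mul_assoc]
  have hρ := pow_pos (rho_pos hp θ) n
  have hexp : Real.exp (n * (pressure p (θ + h) - pressure p θ)) ≤ M := by
    rw [mul_sub, Real.exp_sub, exp_natCast_mul_pressure hp, exp_natCast_mul_pressure hp]
    exact (div_le_iff₀ hρ).2 hle
  exact (Real.le_log_iff_exp_le ((Real.exp_pos _).trans_le hexp)).2 hexp

theorem exists_mul_log_le (hp : p.IsPrimitive) (i : Fin K) (θ : ℝ) :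
    ∃ c : ℝ, ∀ n, ∀ s ∈ boxSizes p i n, θ * Real.log s ≤ n * pressure p θ + c := by
  obtain ⟨v, -, hv⟩ := exists_rho_eigenvector hp θ
  obtain ⟨ε, hε, hbound⟩ := hv.exists_pow_mulVec_one_bounds (powMatrix_nonneg hp.nonneg θ)
  refine ⟨-Real.log ε, fun n s hs => ?_⟩
  have hle : ε * s ^ θ ≤ rho p θ ^ n :=
    (mul_le_mul_of_nonneg_left (rpow_le_powMatrix_pow_mulVec_one hp.nonneg θ hs) hε.le).trans
      (hbound n i).2
  have hlog := Real.log_le_log (mul_pos hε (Real.rpow_pos_of_pos hs.1 θ)) hle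
  rw [Real.log_mul hε.ne' (Real.rpow_pos_of_pos hs.1 θ).ne', Real.log_rpow hs.1,
    Real.log_pow, ← pressure] at hlog
  linarith

theorem exists_natCast_mul_pressure_sub_le (hp : p.IsPrimitive) (i : Fin K) (θ h : ℝ) :
    ∃ c : ℝ, ∀ (n : ℕ) (s : ℝ), 0 < s → (∀ x ∈ boxSizes p i n, x ^ h ≤ s ^ h) →
      n * (pressure p (θ + h) - pressure p θ) - c ≤ h * Real.log s := by
  obtain ⟨v, -, hv⟩ := exists_rho_eigenvector hp θ
  obtain ⟨u, -, hu⟩ := exists_rho_eigenvector hp (θ + h)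
  obtain ⟨ε, hε, hv_bound⟩ := hv.exists_pow_mulVec_one_bounds (powMatrix_nonneg hp.nonneg θ)
  obtain ⟨δ, hδ, hu_bound⟩ := hu.exists_pow_mulVec_one_bounds (powMatrix_nonneg hp.nonneg _)
  refine ⟨-Real.log (ε * δ), fun n s hs hmax => ?_⟩
  have hsh : 0 < s ^ h := Real.rpow_pos_of_pos hs h
  have hle : ε * δ * rho p (θ + h) ^ n ≤ s ^ h * rho p θ ^ n :=
    calc ε * δ * rho p (θ + h) ^ n = ε * (δ * rho p (θ + h) ^ n) := mul_assoc _ _ _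
      _ ≤ ε * (powMatrix p (θ + h) ^ n *ᵥ 1) i := by gcongr; exact (hu_bound n i).1
      _ ≤ ε * (s ^ h * (powMatrix p θ ^ n *ᵥ 1) i) := by
          gcongr; exact powMatrix_add_pow_mulVec_apply_le hp.nonneg hmax zero_le_one
      _ = s ^ h * (ε * (powMatrix p θ ^ n *ᵥ 1) i) := mul_left_comm _ _ _
      _ ≤ s ^ h * rho p θ ^ n := by gcongr; exact (hv_bound n i).2
  have hρθ := pow_pos (rho_pos hp θ) n
  have hρh := pow_pos (rho_pos hp (θ + h)) n
  have hlog := Real.log_le_log (mul_pos (mul_pos hε hδ) hρh) hle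
  rw [Real.log_mul (mul_pos hε hδ).ne' hρh.ne', Real.log_mul hsh.ne' hρθ.ne', Real.log_rpow hs,
    Real.log_pow, Real.log_pow, ← pressure, ← pressure] at hlog
  linarith

end BoxPressure

/-! ### Growth rates and derivatives at infinity of convex functions -/

section Convex

variable {f : ℝ → ℝ}

theorem add_deriv_mul_sub_le (hf : ConvexOn ℝ Set.univ f) {x : ℝ} (hx : DifferentiableAt ℝ f x)
    (y : ℝ) : f x + deriv f x * (y - x) ≤ f y := by
  rcases lt_trichotomy x y with h | rfl | h
  · have hle := hf.deriv_le_slope trivial trivial h hx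
    rw [slope_def_field, le_div_iff₀ (sub_pos.2 h)] at hle
    linarith
  · simp
  · have hle := hf.slope_le_deriv trivial trivial h hx
    rw [slope_def_field, div_le_iff₀ (sub_pos.2 h)] at hle
    linarith

theorem monotone_deriv_of_convexOn (hf : ConvexOn ℝ Set.univ f) (hd : Differentiable ℝ f) :
    Monotone (deriv f) :=
  monotoneOn_univ.1 (hf.monotoneOn_deriv fun x _ => hd x)

theorem eventually_lt_div_natCast {a : ℕ → ℝ} {m c κ : ℝ} (hm : m < κ)
    (h : ∀ n : ℕ, n * κ - c ≤ a n) : ∀ᶠ n : ℕ in atTop, m < a n / n := by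
  have hlim : Tendsto (fun n : ℕ => κ - c / n) atTop (𝓝 κ) := by
    simpa using (tendsto_const_div_atTop_nhds_zero_nat c).const_sub κ
  filter_upwards [hlim.eventually_const_lt hm, eventually_gt_atTop 0] with n hn hpos
  have hpos' : (0 : ℝ) < n := Nat.cast_pos.2 hpos
  refine hn.trans_le ((le_div_iff₀ hpos').2 ?_)
  rw [sub_mul, div_mul_cancel₀ _ hpos'.ne', mul_comm]
  exact h n

theorem tendsto_div_natCast_of_convexOn (hf : ConvexOn ℝ Set.univ f) (hd : Differentiable ℝ f)
    {L : ℝ} (hL : Tendsto (deriv f) atTop (𝓝 L)) {a : ℕ → ℝ}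
    (hlower : ∀ θ, ∃ c, ∀ n : ℕ, n * (f (θ + 1) - f θ) - c ≤ a n)
    (hupper : ∀ θ > 0, ∃ c, ∀ n : ℕ, θ * a n ≤ n * f θ + c) :
    Tendsto (fun n : ℕ => a n / n) atTop (𝓝 L) := by
  refine tendsto_order.2 ⟨fun m hm => ?_, fun m hm => ?_⟩
  · obtain ⟨θ, hθ⟩ := (hL.eventually_const_lt hm).exists
    obtain ⟨c, hc⟩ := hlower θ
    have htangent := add_deriv_mul_sub_le hf (hd θ) (θ + 1)
    exact eventually_lt_div_natCast (κ := f (θ + 1) - f θ) (by linarith) hc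
  · have hfL : ∀ θ > 0, f θ ≤ f 0 + L * θ := fun θ hθ => by
      have htangent := add_deriv_mul_sub_le hf (hd θ) 0
      have hderiv := (monotone_deriv_of_convexOn hf hd).ge_of_tendsto hL θ
      nlinarith
    have hlim : Tendsto (fun θ : ℝ => f 0 / θ + L) atTop (𝓝 L) := by
      simpa using (tendsto_const_nhds.div_atTop tendsto_id).add_const L
    obtain ⟨θ, hθm, hθ⟩ := ((hlim.eventually_lt_const hm).and (eventually_gt_atTop 0)).exists
    obtain ⟨c, hc⟩ := hupper θ hθ
    have hrate : f θ / θ < m := by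
      refine lt_of_le_of_lt ?_ hθm
      rw [div_le_iff₀ hθ, add_mul, div_mul_cancel₀ _ hθ.ne']
      exact hfL θ hθ
    have hneg : ∀ᶠ n : ℕ in atTop, -m < -a n / n := by
      refine eventually_lt_div_natCast (c := c / θ) (neg_lt_neg hrate) fun n => ?_
      rw [mul_neg, mul_div_assoc', ← neg_add', neg_le_neg_iff, ← add_div, le_div_iff₀ hθ, mul_comm]
      exact hc n
    exact hneg.mono fun n hn => neg_lt_neg_iff.1 (neg_div (n : ℝ) (a n) ▸ hn)

end Convex

/-! ### Limits of the derivative of the pressure and growth rates of the boxes -/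

theorem exists_deriv_pressure_mem_Icc (hK : 2 ≤ K) (hp : p ∈ rowStochastic ℝ (Fin K))
    (hprim : p.IsPrimitive) : ∃ m, ∃ M < 0, ∀ θ, deriv (pressure p) θ ∈ Set.Icc m M := by
  have : NeZero K := ⟨by omega⟩
  have : Nontrivial (Fin K) := Fin.nontrivial_iff_two_le.2 hK
  obtain ⟨N, hN, hpos⟩ := hprim.exists_pos_pow
  have hrow := exists_apply_pos_of_isPrimitive hprim
  obtain ⟨a, ha, b, hb, hbox⟩ :=
    exists_boxSizes_subset_Icc hprim.nonneg hrow
      (apply_lt_one_of_mem_rowStochastic (pow_mem hp N) hpos)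
  obtain ⟨s, hs⟩ := nonempty_boxSizes hrow 0 N
  have hb0 : 0 < b := hs.1.trans_le (hbox 0 hs).2
  have hN' : (0 : ℝ) < N := Nat.cast_pos.2 hN
  refine ⟨Real.log a / N, Real.log b / N, div_neg_of_neg_of_pos (Real.log_neg hb0 hb) hN',
    fun θ => ?_⟩
  have htangent := add_deriv_mul_sub_le (convexOn_pressure hprim) (differentiable_pressure hprim θ)
  constructor
  · have hlower : N * (pressure p (θ + -1) - pressure p θ) ≤ Real.log a⁻¹ :=
      natCast_mul_pressure_sub_le hprim fun i s hs => by
        rw [Real.rpow_neg_one]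
        exact inv_anti₀ ha (hbox i hs).1
    rw [Real.log_inv] at hlower
    rw [div_le_iff₀ hN']
    nlinarith [htangent (θ + -1)]
  · have hupper : N * (pressure p (θ + 1) - pressure p θ) ≤ Real.log b :=
      natCast_mul_pressure_sub_le hprim fun i s hs => by
        rw [Real.rpow_one]
        exact (hbox i hs).2
    rw [le_div_iff₀ hN']
    nlinarith [htangent (θ + 1)]

theorem exists_tendsto_deriv_pressure (hK : 2 ≤ K) (hp : p ∈ rowStochastic ℝ (Fin K))
    (hprim : p.IsPrimitive) : ∃ l L, l ≤ L ∧ L < 0 ∧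
      Tendsto (deriv (pressure p)) atBot (𝓝 l) ∧ Tendsto (deriv (pressure p)) atTop (𝓝 L) := by
  have : NeZero K := ⟨by omega⟩
  obtain ⟨m, M, hM, hmem⟩ := exists_deriv_pressure_mem_Icc hK hp hprim
  have hmono := monotone_deriv_of_convexOn (convexOn_pressure hprim) (differentiable_pressure hprim)
  have hbelow : BddBelow (Set.range (deriv (pressure p))) :=
    ⟨m, Set.forall_mem_range.2 fun θ => (hmem θ).1⟩
  have habove : BddAbove (Set.range (deriv (pressure p))) :=
    ⟨M, Set.forall_mem_range.2 fun θ => (hmem θ).2⟩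
  exact ⟨_, _, (ciInf_le hbelow 0).trans (le_ciSup habove 0),
    (ciSup_le fun θ => (hmem θ).2).trans_lt hM, tendsto_atBot_ciInf hmono hbelow,
    tendsto_atTop_ciSup hmono habove⟩

theorem deriv_rho_neg (hK : 2 ≤ K) (hp : p ∈ rowStochastic ℝ (Fin K))
    (hprim : p.IsPrimitive) (θ : ℝ) : deriv (rho p) θ < 0 := by
  have : NeZero K := ⟨by omega⟩
  obtain ⟨m, M, hM, hmem⟩ := exists_deriv_pressure_mem_Icc hK hp hprim
  have hneg := (hmem θ).2.trans_lt hM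
  rw [(hasDerivAt_pressure hprim θ).deriv] at hneg
  exact neg_of_div_neg_left hneg (rho_pos hprim θ).le

theorem rho_div_neg_deriv_rho [NeZero K] (hprim : p.IsPrimitive) (θ : ℝ) :
    rho p θ / (-deriv (rho p) θ) = -(deriv (pressure p) θ)⁻¹ := by
  rw [(hasDerivAt_pressure hprim θ).deriv, inv_div, div_neg]

theorem tendsto_log_largestBox_div [NeZero K] (hprim : p.IsPrimitive) (i : Fin K) {L : ℝ}
    (hL : Tendsto (deriv (pressure p)) atTop (𝓝 L)) :
    Tendsto (fun n : ℕ => Real.log (largestBox p i n) / n) atTop (𝓝 L) := by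
  have hmax := isGreatest_largestBox (exists_apply_pos_of_isPrimitive hprim) i
  refine tendsto_div_natCast_of_convexOn (convexOn_pressure hprim)
    (differentiable_pressure hprim) hL (fun θ => ?_) fun θ _ => ?_
  · obtain ⟨c, hc⟩ := exists_natCast_mul_pressure_sub_le hprim i θ 1
    refine ⟨c, fun n => (hc n _ (hmax n).1.1 fun x hx => ?_).trans_eq (one_mul _)⟩
    simpa using (hmax n).2 hx
  · obtain ⟨c, hc⟩ := exists_mul_log_le hprim i θ
    exact ⟨c, fun n => hc n _ (hmax n).1⟩

theorem tendsto_log_smallestBox_div [NeZero K] (hprim : p.IsPrimitive) (i : Fin K) {l : ℝ}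
    (hl : Tendsto (deriv (pressure p)) atBot (𝓝 l)) :
    Tendsto (fun n : ℕ => Real.log (smallestBox p i n) / n) atTop (𝓝 l) := by
  have hmin := isLeast_smallestBox (exists_apply_pos_of_isPrimitive hprim) i
  have hconvex : ConvexOn ℝ Set.univ fun θ => pressure p (-θ) := by
    simpa [Function.comp_def] using
      (convexOn_pressure hprim).comp_linearMap (-LinearMap.id : ℝ →ₗ[ℝ] ℝ)
  have hderiv : Tendsto (deriv fun θ => pressure p (-θ)) atTop (𝓝 (-l)) := by
    rw [funext (deriv_comp_neg (pressure p))]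
    exact (hl.comp tendsto_neg_atTop_atBot).neg
  have hrate := tendsto_div_natCast_of_convexOn
    (a := fun n => -Real.log (smallestBox p i n)) hconvex
    ((differentiable_pressure hprim).comp differentiable_neg) hderiv (fun θ => ?_) fun θ _ => ?_
  · simpa [neg_div] using hrate.neg
  · obtain ⟨c, hc⟩ := exists_natCast_mul_pressure_sub_le hprim i (-θ) (-1)
    refine ⟨c, fun n => ?_⟩
    have hle := hc n _ (hmin n).1.1 fun x hx => by
      rw [Real.rpow_neg_one, Real.rpow_neg_one]
      exact inv_anti₀ (hmin n).1.1 ((hmin n).2 hx)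
    rwa [← neg_add, neg_one_mul] at hle
  · obtain ⟨c, hc⟩ := exists_mul_log_le hprim i (-θ)
    refine ⟨c, fun n => ?_⟩
    rw [mul_neg, ← neg_mul]
    exact hc n _ (hmin n).1

end MarkovBoxes

theorem mainTheorem8 (K : ℕ) (hK : 2 ≤ K) (p : Matrix (Fin K) (Fin K) ℝ)
    (hp : p ∈ Matrix.rowStochastic ℝ (Fin K)) (hirr : p.IsIrreducible)
    (haper : MarkovBoxes.IsAperiodic p) (i₀ : Fin K) :
    -- `ρ(θ)` and the quotient `ρ(θ) / (-ρ'(θ))` are well defined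
    (∀ θ : ℝ, MarkovBoxes.IsMaxModulusEigenvalue (MarkovBoxes.powMatrix p θ)
        (MarkovBoxes.rho p θ)) ∧
    Differentiable ℝ (MarkovBoxes.rho p) ∧
    (∀ θ : ℝ, deriv (MarkovBoxes.rho p) θ < 0) ∧
    -- the smallest and the largest box exist
    (∀ n : ℕ, IsLeast (MarkovBoxes.boxSizes p i₀ n) (MarkovBoxes.smallestBox p i₀ n)) ∧
    (∀ n : ℕ, IsGreatest (MarkovBoxes.boxSizes p i₀ n) (MarkovBoxes.largestBox p i₀ n)) ∧
    -- `c` is `C_*` and `C` is `C^*`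
    ∃ c C : ℝ,
      Tendsto (fun θ : ℝ => MarkovBoxes.rho p θ / (-deriv (MarkovBoxes.rho p) θ)) atBot (𝓝 c) ∧
      Tendsto (fun θ : ℝ => MarkovBoxes.rho p θ / (-deriv (MarkovBoxes.rho p) θ)) atTop (𝓝 C) ∧
      0 < c ∧ c ≤ C ∧
      Tendsto (fun n : ℕ => Real.log (MarkovBoxes.smallestBox p i₀ n) / n) atTop (𝓝 (-1 / c)) ∧
      Tendsto (fun n : ℕ => Real.log (MarkovBoxes.largestBox p i₀ n) / n) atTop (𝓝 (-1 / C)) := by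
  have : NeZero K := ⟨by omega⟩
  have hprim := MarkovBoxes.isPrimitive_of_isIrreducible_of_isAperiodic hirr haper
  obtain ⟨l, L, hlL, hL, hbot, htop⟩ := MarkovBoxes.exists_tendsto_deriv_pressure hK hp hprim
  have hl : l < 0 := hlL.trans_lt hL
  have hrow := MarkovBoxes.exists_apply_pos_of_isPrimitive hprim
  have hquot := MarkovBoxes.rho_div_neg_deriv_rho hprim
  refine ⟨MarkovBoxes.isMaxModulusEigenvalue_rho hprim, MarkovBoxes.differentiable_rho hprim,
    MarkovBoxes.deriv_rho_neg hK hp hprim, MarkovBoxes.isLeast_smallestBox hrow i₀,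
    MarkovBoxes.isGreatest_largestBox hrow i₀, -l⁻¹, -L⁻¹, ?_, ?_, neg_pos.2 (inv_lt_zero.2 hl),
    neg_le_neg ((inv_le_inv_of_neg hL hl).2 hlL), ?_, ?_⟩
  · simpa only [hquot] using (hbot.inv₀ hl.ne).neg
  · simpa only [hquot] using (htop.inv₀ hL.ne).neg
  · simpa [neg_div_neg_eq] using MarkovBoxes.tendsto_log_smallestBox_div hprim i₀ hbot
  · simpa [neg_div_neg_eq] using MarkovBoxes.tendsto_log_largestBox_div hprim i₀ htop
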